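/- Let $f:\mathbb{R}^n\times\mathbb{R}^m\to\mathbb{R}$, $\phi:\mathbb{R}^n\to\mathbb{R}^{p_1+p_2}$ and $\varphi:\mathbb{R}^n\times\mathbb{R}^m\to\mathbb{R}^{q_1+q_2}$ be continuously differentiable, let $C=\mathbb{R}^{p_1}_-\times\{0\}^{p_2}$, $D=\mathbb{R}^{q_1}_-\times\{0\}^{q_2}$, $X=\{x:\phi(x)\in C\}$, $Y(x)=\{y:\varphi(x,y)\in D\}$, and consider $\min_{x\in X}\max_{y\in Y(x)}f(x,y)$. Write $\phi=(\phi_{\le},\phi_{=})$ and $\varphi=(\varphi_{\le},\varphi_{=})$ for the inequality and equality components, $\mathbb{B}_r(z)$ for the closed Euclidean ball, and $$L(x,y,\alpha,\beta)=f(x,y)+\phi(x)^T\alpha-\varphi(x,y)^T\beta .$$ Let $(\bar x,\bar y)$ be a calm local minimax point, that is, $\bar x\in X$, $\bar y\in Y(\bar x)$, and there are $\delta_0>0$, $\kappa>0$ and a function $\tau:\mathbb{R}_+\to\mathbb{R}_+$ with $\tau(\delta)\to0$ as $\delta\downarrow0$ and $\tau(\delta)\le\kappa\delta$ such that for all $\delta\in(0,\delta_0]$,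 $x\in X\cap\mathbb{B}_\delta(\bar x)$ and $y\in Y(\bar x)\cap\mathbb{B}_\delta(\bar y)$, $$f(\bar x,y)\le f(\bar x,\bar y)\le\max_{y'\in Y(x)\cap\mathbb{B}_{\tau(\delta)}(\bar y)}f(x,y')$$ (in particular, the set over which the maximum is taken is nonempty and the maximum is attained). Suppose that the metric subregularity constraint qualification holds for the system $\phi(x)\in C$ at $\bar x$: there are a neighbourhood $U$ of $\bar x$ and $\rho>0$ with $\operatorname{dist}(x,X)\le\rho\operatorname{dist}(\phi(x),C)$ for all $x\in U$. With $I=\{i\le q_1:\varphi_{\le,i}(\bar x,\bar y)=0\}$, suppose moreover that one of the following holds: (i) (MFCQ) the vectors $\nabla_y\varphi_{=,j}(\bar x,\bar y)$, $j=1,\dots,q_2$, are linearly independent, and there is $w\in\mathbb{R}^m$ with $\nabla_y\varphi_{=,j}(\bar x,\bar y)^Tw=0$ for $j=1,\dots,q_2$ and $\nabla_y\varphi_{\le,i}(\bar x,\bar y)^Tw<0$ for $i\in I$; (ii) (RCRCQ) for every $K\subseteq I$, the rank of the family consisting of all $\nabla_y\varphi_{=,j}(x,y)$, $j=1,\dots,q_2$,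 and all $\nabla_y\varphi_{\le,i}(x,y)$, $i\in K$, is constant for $(x,y)$ in a neighbourhood of $(\bar x,\bar y)$; (iii) $\varphi(x,y)=a(x)+By+c$ with $a:\mathbb{R}^n\to\mathbb{R}^{q_1+q_2}$ continuous, $B\in\mathbb{R}^{(q_1+q_2)\times m}$ and $c\in\mathbb{R}^{q_1+q_2}$, and $Y(x)$ is nonempty for all $x$ in a neighbourhood of $\bar x$. Then there exist $\alpha=(\alpha_1,\alpha_2)\in\mathbb{R}^{p_1}_+\times\mathbb{R}^{p_2}$ and $\beta=(\beta_1,\beta_2)\in\mathbb{R}^{q_1}_+\times\mathbb{R}^{q_2}$ such that $\alpha_1\perp\phi_{\le}(\bar x)$, $\beta_1\perp\varphi_{\le}(\bar x,\bar y)$ and $$\nabla_{(x,y)}L(\bar x,\bar y,\alpha,\beta)=0 .$$ -/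

import Mathlib

open Set Filter Topology
open scoped NNReal InnerProductSpace Gradient

/-- `ℝⁿ` with its Euclidean norm. -/
abbrev Euc (n : ℕ) : Type := EuclideanSpace ℝ (Fin n)

/-- `ℝ^{r₁ + r₂}` with its Euclidean norm; the coordinates `Sum.inl i` are those of the `r₁`
inequality constraints, the coordinates `Sum.inr j` those of the `r₂` equality constraints. -/
abbrev EucSum (r₁ r₂ : ℕ) : Type := EuclideanSpace ℝ (Fin r₁ ⊕ Fin r₂)

/-- The closed convex cone `ℝ₋^{r₁} × {0}^{r₂}`. -/
def mixedCone (r₁ r₂ : ℕ) : Set (EucSum r₁ r₂) :=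
  {v | (∀ i : Fin r₁, v (Sum.inl i) ≤ 0) ∧ ∀ j : Fin r₂, v (Sum.inr j) = 0}

/-- The set `{z | g z ∈ S}` of solutions of a constraint system. -/
def feasibleSet {E F : Type*} (g : E → F) (S : Set F) : Set E := {z | g z ∈ S}

/-- The set-valued map `x ↦ {y | φ (x, y) ∈ S}`. -/
def feasibleMap {E E' F : Type*} (φ : E × E' → F) (S : Set F) (x : E) : Set E' :=
  {y | φ (x, y) ∈ S}

/-- Metric subregularity constraint qualification for the system `g z ∈ S` at a solution `zbar`:
`dist (z, {g ∈ S}) ≤ ρ dist (g z, S)` for all `z` near `zbar`. -/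
def MSCQ {E F : Type*} [PseudoMetricSpace E] [PseudoMetricSpace F]
    (g : E → F) (S : Set F) (zbar : E) : Prop :=
  zbar ∈ feasibleSet g S ∧
    ∃ U ∈ 𝓝 zbar, ∃ ρ : ℝ, 0 < ρ ∧
      ∀ z ∈ U, Metric.infDist z (feasibleSet g S) ≤ ρ * Metric.infDist (g z) S

/-- `(xbar, ybar)` is a calm local minimax point of `min_{x ∈ X} max_{y ∈ Y x} f (x, y)`.
The number `M` is the maximum of `f (x, ·)` over `Y x ∩ closedBall ybar (τ δ)`. -/
def IsCalmLocalMinimax {n m : ℕ} (f : Euc n × Euc m → ℝ) (X : Set (Euc n))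
    (Y : Euc n → Set (Euc m)) (xbar : Euc n) (ybar : Euc m) : Prop :=
  xbar ∈ X ∧ ybar ∈ Y xbar ∧
    ∃ δ₀ : ℝ≥0, 0 < δ₀ ∧ ∃ τ : ℝ≥0 → ℝ≥0,
      Tendsto τ (𝓝[>] 0) (𝓝 0) ∧
      (∃ κ : ℝ≥0, 0 < κ ∧ ∀ δ, τ δ ≤ κ * δ) ∧
      ∀ δ : ℝ≥0, 0 < δ → δ ≤ δ₀ →
        ∀ x ∈ X ∩ Metric.closedBall xbar δ, ∀ y ∈ Y xbar ∩ Metric.closedBall ybar δ,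
          f (xbar, y) ≤ f (xbar, ybar) ∧
            ∃ M : ℝ, IsGreatest
                ((fun y' => f (x, y')) '' (Y x ∩ Metric.closedBall ybar (τ δ))) M ∧
              f (xbar, ybar) ≤ M

section ConstraintQualifications

variable {n m q₁ q₂ : ℕ}

/-- The partial gradient `∇_y φ_i (x, y)`. -/
noncomputable def gradY (φ : Euc n × Euc m → EucSum q₁ q₂) (x : Euc n) (y : Euc m)
    (i : Fin q₁ ⊕ Fin q₂) : Euc m :=
  ∇ (fun y' : Euc m => φ (x, y') i) y

/-- The indices of the inequality constraints that are active at `(x, y)`. -/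
def activeSet (φ : Euc n × Euc m → EucSum q₁ q₂) (x : Euc n) (y : Euc m) : Set (Fin q₁) :=
  {i | φ (x, y) (Sum.inl i) = 0}

/-- Mangasarian–Fromovitz constraint qualification at `ybar` for the system
`φ (xbar, ·) ∈ ℝ₋^{q₁} × {0}^{q₂}`. -/
def MFCQ (φ : Euc n × Euc m → EucSum q₁ q₂) (xbar : Euc n) (ybar : Euc m) : Prop :=
  LinearIndependent ℝ (fun j : Fin q₂ => gradY φ xbar ybar (Sum.inr j)) ∧
    ∃ w : Euc m, (∀ j : Fin q₂, ⟪gradY φ xbar ybar (Sum.inr j), w⟫_ℝ = 0) ∧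
      ∀ i ∈ activeSet φ xbar ybar, ⟪gradY φ xbar ybar (Sum.inl i), w⟫_ℝ < 0

/-- Relaxed constant rank constraint qualification at `(xbar, ybar)`: for each set `K` of active
inequality indices, the rank of the `y`-gradients of all the equality constraints and of the
inequality constraints in `K` is constant near `(xbar, ybar)`. -/
def RCRCQ (φ : Euc n × Euc m → EucSum q₁ q₂) (xbar : Euc n) (ybar : Euc m) : Prop :=
  ∀ K : Set (Fin q₁), K ⊆ activeSet φ xbar ybar →
    ∀ᶠ z : Euc n × Euc m in 𝓝 (xbar, ybar),
      Set.finrank ℝ (gradY φ z.1 z.2 '' (range Sum.inr ∪ Sum.inl '' K)) =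
        Set.finrank ℝ (gradY φ xbar ybar '' (range Sum.inr ∪ Sum.inl '' K))

/-- `φ (x, y) = a x + B y + c` with `a` continuous and `B` linear. -/
def IsAffineInY (φ : Euc n × Euc m → EucSum q₁ q₂) : Prop :=
  ∃ (a : Euc n → EucSum q₁ q₂) (B : Euc m →ₗ[ℝ] EucSum q₁ q₂) (c : EucSum q₁ q₂),
    Continuous a ∧ ∀ x y, φ (x, y) = a x + B y + c

end ConstraintQualifications

/-- The Lagrangian `L (x, y, α, β) = f (x, y) + φ(x)ᵀ α - ψ(x, y)ᵀ β`. -/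
noncomputable def lagrangian {n m p₁ p₂ q₁ q₂ : ℕ} (f : Euc n × Euc m → ℝ)
    (φ : Euc n → EucSum p₁ p₂) (ψ : Euc n × Euc m → EucSum q₁ q₂)
    (α : EucSum p₁ p₂) (β : EucSum q₁ q₂) (z : Euc n × Euc m) : ℝ :=
  f z + ⟪φ z.1, α⟫_ℝ - ⟪ψ z, β⟫_ℝ

/-! The inner problem supplies `β`, and `β` turns the outer problem into first-order stationarity on
`X`. Since `ybar` is a local maximizer of `f (xbar, ·)` over the inner feasible set at `xbar`, any
of the constraint qualifications yields a KKT multiplier `β`. Put `H z = f z - ⟪ψ z, β⟫`. Its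
`y`-derivative vanishes at `(xbar, ybar)`, and complementarity gives `H (xbar, ybar) = f (xbar,
ybar)`. For feasible `x` near `xbar`, take a maximizer `y` with `‖y - ybar‖ ≤ κ ‖x - xbar‖`. The
signs of `β` and `ψ (x, y)` give `H (xbar, ybar) ≤ f (x, y) ≤ H (x, y)`, and by calmness the
expansion of `H` has error `o(‖x - xbar‖)`. Hence the `x`-derivative of `H` is nonnegative to first
order along `X` (`IsCalmLocalMinimax.neg_mul_norm_le`). Metric subregularity extends this to the
linearized cone (`MSCQ.nonneg_of_mem_linearizedCone`), and Farkas' lemma produces `α`.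

The multiplier `β` comes from a quadratic penalty: `mem_closure_multiplierGraph_of_isLocalMaxOn`
puts the gradient of the objective in the closure of the graph of multiplier combinations, with no
qualification. The qualification serves only to show that this graph is closed at the point, by
boundedness of multipliers (MFCQ) or by reduction to independent subfamilies (constant rank). -/

/-! ### Conic Carathéodory reductions -/

theorem exists_linearIndepOn_support_sum_smul_eq {σ W : Type*} [Fintype σ] [AddCommGroup W]
    [Module ℝ W] (b : σ → W) (c : σ → ℝ) (hc : ∀ s, 0 ≤ c s) :
    ∃ c' : σ → ℝ, (∀ s, 0 ≤ c' s) ∧ Function.support c' ⊆ Function.support c ∧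
      LinearIndepOn ℝ b (Function.support c') ∧ ∑ s, c' s • b s = ∑ s, c s • b s := by
  classical
  induction hn : (Finset.univ.filter fun s => c s ≠ 0).card using Nat.strong_induction_on
    generalizing c with
  | _ n ih =>
  by_cases hli : LinearIndepOn ℝ b (Function.support c)
  · exact ⟨c, hc, subset_rfl, hli, rfl⟩
  obtain ⟨γ, hγs, hγ0, hγne⟩ : ∃ γ : σ → ℝ, (∀ s, c s = 0 → γ s = 0) ∧ ∑ s, γ s • b s = 0 ∧
      ∃ s, 0 < γ s := by
    obtain ⟨g, hgs, hg0, hgne⟩ := linearDepOn_iff'.1 hli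
    have hsup : ∀ s, c s = 0 → g s = 0 := fun s hs => by
      by_contra h
      exact hgs (Finsupp.mem_support_iff.2 h) hs
    have hsum : ∑ s, g s • b s = 0 := by
      rw [← hg0, Finsupp.linearCombination_apply, Finsupp.sum_fintype _ _ (by simp)]
    obtain ⟨s, hs⟩ := Finsupp.ne_iff.1 hgne
    rcases lt_or_gt_of_ne hs with h | h
    · exact ⟨fun s => -g s, fun s hs => by simp [hsup s hs], by simp [hsum], s, by simpa using h⟩
    · exact ⟨g, hsup, hsum, s, h⟩
  -- The minimal ratio `c s / γ s` is the largest multiple of `γ` that can be subtracted from `c`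
  -- without losing nonnegativity; it kills the coefficient at `s₀`.
  obtain ⟨s₀, hs₀, hmin⟩ := (Finset.univ.filter fun s => 0 < γ s).exists_min_image
    (fun s => c s / γ s) (by simpa [Finset.Nonempty] using hγne)
  simp only [Finset.mem_filter, Finset.mem_univ, true_and] at hs₀ hmin
  set t := c s₀ / γ s₀ with ht
  have ht0 : 0 ≤ t := div_nonneg (hc _) hs₀.le
  set d : σ → ℝ := fun s => c s - t * γ s with hd
  have hd0 : ∀ s, 0 ≤ d s := fun s => by
    rcases le_or_gt (γ s) 0 with h | h
    · have := mul_nonneg ht0 (neg_nonneg.2 h)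
      have := hc s
      simp only [hd]; linarith
    · have := (le_div_iff₀ h).1 (hmin s h)
      simp only [hd]; linarith
  have hdc : ∀ s, c s = 0 → d s = 0 := fun s hs => by simp [hd, hs, hγs s hs]
  have hds : d s₀ = 0 := by simp [hd, ht, hs₀.ne']
  have hcs : c s₀ ≠ 0 := fun h => hs₀.ne' (hγs _ h)
  have hlt : (Finset.univ.filter fun s => d s ≠ 0).card < n := by
    rw [← hn]
    refine Finset.card_lt_card ((Finset.ssubset_iff_of_subset fun s hs => ?_).2 ⟨s₀, ?_, ?_⟩)
    · simp only [Finset.mem_filter, Finset.mem_univ, true_and] at hs ⊢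
      exact fun h => hs (hdc s h)
    · simpa using hcs
    · simpa using hds
  obtain ⟨c', h1, h2, h3, h4⟩ := ih _ hlt d hd0 rfl
  refine ⟨c', h1, fun s hs h => h2 hs (hdc s h), h3, ?_⟩
  rw [h4]
  simp only [hd, sub_smul, mul_smul, Finset.sum_sub_distrib, ← Finset.smul_sum, hγ0, smul_zero,
    sub_zero]

/-- Conic Carathéodory in the quotient by the span of `a '' J`: coefficients on `Q` have free sign,
so the error made when lifting back is absorbed by the basis `J` of that span. -/
theorem exists_linearIndepOn_union_sum_smul_eq {σ W : Type*} [Fintype σ] [AddCommGroup W]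
    [Module ℝ W] (a : σ → W) {J Q : Set σ} (hJQ : J ⊆ Q) (hJ : LinearIndepOn ℝ a J)
    (hQ : a '' Q ⊆ Submodule.span ℝ (a '' J)) (β : σ → ℝ) (hβ : ∀ s ∉ Q, 0 ≤ β s) :
    ∃ K ⊆ Function.support β \ Q, LinearIndepOn ℝ a (J ∪ K) ∧ ∃ β' : σ → ℝ,
      (∀ s ∉ Q, 0 ≤ β' s) ∧ (∀ s ∉ J ∪ K, β' s = 0) ∧ ∑ s, β' s • a s = ∑ s, β s • a s := by
  classical
  set V := Submodule.span ℝ (a '' J) with hV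
  set c : σ → ℝ := fun s => if s ∈ Q then 0 else β s with hc
  obtain ⟨c', h1, h2, h3, h4⟩ := exists_linearIndepOn_support_sum_smul_eq (V.mkQ ∘ a) c
    (fun s => by by_cases h : s ∈ Q <;> simp [hc, h, hβ])
  have hmem : ∑ s, β s • a s - ∑ s, c' s • a s ∈ V := by
    rw [← Submodule.Quotient.mk_eq_zero, ← Submodule.mkQ_apply, map_sub, map_sum, map_sum,
      sub_eq_zero]
    simp only [Function.comp_apply] at h4
    simp only [map_smul]
    rw [h4]
    refine Finset.sum_congr rfl fun s _ => ?_
    by_cases h : s ∈ Q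
    · have : V.mkQ (a s) = 0 := by simpa using hQ (mem_image_of_mem a h)
      simp [this]
    · simp [hc, h]
  rw [hV, Fintype.mem_span_image_iff_exists_fun] at hmem
  obtain ⟨d, hd⟩ := hmem
  set d' : σ → ℝ := fun s => if h : s ∈ J then d ⟨s, h⟩ else 0 with hd'
  have hdsum : ∑ s, d' s • a s = ∑ s, β s • a s - ∑ s, c' s • a s := by
    rw [← hd]
    exact Finset.sum_congr_set J _ _ (fun s hs => by simp [hd', hs]) (fun s hs => by simp [hd', hs])
  refine ⟨Function.support c', fun s hs => ?_, hJ.union_of_quotient h3, fun s => c' s + d' s,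
    fun s hs => ?_, fun s hs => ?_, ?_⟩
  · have := h2 hs
    by_cases h : s ∈ Q
    · simp [hc, h] at this
    · exact ⟨by simpa [hc, h] using this, h⟩
  · have : s ∉ J := fun h => hs (hJQ h)
    simp [hd', this, h1]
  · simp only [mem_union, not_or, Function.mem_support, not_not] at hs
    simp [hd', hs.1, hs.2]
  · simp only [add_smul, Finset.sum_add_distrib, hdsum]
    abel

/-! ### Closedness of the multiplier graph at a point -/

section

variable {σ E : Type*} [Fintype σ] [NormedAddCommGroup E] [NormedSpace ℝ E]

/-- The graph of the map sending `y` to the vectors `∑ s, β s • a s y` whose coefficients are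
nonnegative on `N` and vanish off `S`. -/
def multiplierGraph (a : σ → E → E) (N S : Set σ) : Set (E × E) :=
  {p | ∃ β : σ → ℝ, (∀ s ∈ N, 0 ≤ β s) ∧ (∀ s ∉ S, β s = 0) ∧ ∑ s, β s • a s p.1 = p.2}

/-- Unbounded multipliers, once normalized, would converge to a nonzero sign-feasible relation among
the limit vectors, which `hpos` excludes. -/
theorem mem_multiplierGraph_of_mem_closure {a : σ → E → E} {N S : Set σ} {y w : E}
    (ha : ∀ s, ContinuousAt (a s) y)
    (hpos : ∀ γ : σ → ℝ, (∀ s ∈ N, 0 ≤ γ s) → (∀ s ∉ S, γ s = 0) → ∑ s, γ s • a s y = 0 → γ = 0)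
    (h : (y, w) ∈ closure (multiplierGraph a N S)) : (y, w) ∈ multiplierGraph a N S := by
  obtain ⟨u, hu, hlim⟩ := mem_closure_iff_seq_limit.1 h
  choose β hβN hβS hβ using hu
  -- With this scaling `(t, t • β)` stays in a compact set and `t + ‖t • β‖ = 1`. The limit thus
  -- satisfies `t₀ + ‖γ‖ = 1`, and `t₀ = 0` would force `γ ≠ 0`; bounded and unbounded sequences
  -- need no separate treatment.
  set t : ℕ → ℝ := fun k => (1 + ‖β k‖)⁻¹ with ht
  have ht0 : ∀ k, 0 < 1 + ‖β k‖ := fun k => by positivity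
  have hmem : ∀ k, (t k, t k • β k) ∈ Icc (0 : ℝ) 1 ×ˢ Metric.closedBall (0 : σ → ℝ) 1 := by
    intro k
    refine ⟨⟨(inv_pos.2 (ht0 k)).le, inv_le_one_of_one_le₀ (by simp)⟩, ?_⟩
    rw [mem_closedBall_zero_iff, norm_smul, Real.norm_of_nonneg (inv_pos.2 (ht0 k)).le,
      inv_mul_le_iff₀ (ht0 k)]
    linarith
  obtain ⟨⟨t₀, γ⟩, -, φ, hφ, hconv⟩ :=
    (isCompact_Icc.prod (isCompact_closedBall (0 : σ → ℝ) 1)).tendsto_subseq hmem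
  have hlimφ := hlim.comp hφ.tendsto_atTop
  have hy : Tendsto (fun k => (u (φ k)).1) atTop (𝓝 y) := (continuous_fst.tendsto _).comp hlimφ
  have hw : Tendsto (fun k => (u (φ k)).2) atTop (𝓝 w) := (continuous_snd.tendsto _).comp hlimφ
  have ht₀ : Tendsto (fun k => t (φ k)) atTop (𝓝 t₀) := (continuous_fst.tendsto _).comp hconv
  have hγ : Tendsto (fun k => t (φ k) • β (φ k)) atTop (𝓝 γ) :=
    (continuous_snd.tendsto _).comp hconv
  have hγs : ∀ s, Tendsto (fun k => t (φ k) * β (φ k) s) atTop (𝓝 (γ s)) := fun s =>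
    ((continuous_apply s).tendsto _).comp hγ
  have hsum : t₀ + ‖γ‖ = 1 := by
    refine tendsto_nhds_unique (ht₀.add hγ.norm) (tendsto_const_nhds.congr fun k => ?_)
    rw [norm_smul, Real.norm_of_nonneg (inv_pos.2 (ht0 _)).le]
    have := (ht0 (φ k)).ne'
    simp only [ht]; field_simp
  have hγN : ∀ s ∈ N, 0 ≤ γ s := fun s hs =>
    ge_of_tendsto' (hγs s) fun k => mul_nonneg (inv_pos.2 (ht0 _)).le (hβN _ s hs)
  have hγS : ∀ s ∉ S, γ s = 0 := fun s hs =>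
    tendsto_nhds_unique (hγs s) (tendsto_const_nhds.congr fun k => by simp [hβS _ s hs])
  have hlin : ∑ s, γ s • a s y = t₀ • w := by
    refine tendsto_nhds_unique
      (tendsto_finsetSum _ fun s _ => (hγs s).smul ((ha s).tendsto.comp hy))
      ((ht₀.smul hw).congr fun k => ?_)
    simp only [Function.comp_apply, mul_smul]
    rw [← Finset.smul_sum, hβ]
  have ht₀pos : 0 < t₀ := by
    refine lt_of_le_of_ne (ge_of_tendsto' ht₀ fun k => (inv_pos.2 (ht0 _)).le) fun h0 => ?_
    have := hpos γ hγN hγS (by rw [hlin, ← h0, zero_smul])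
    simp [this, ← h0] at hsum
  refine ⟨t₀⁻¹ • γ, fun s hs => mul_nonneg (inv_pos.2 ht₀pos).le (hγN s hs),
    fun s hs => by simp [hγS s hs], ?_⟩
  simp only [Pi.smul_apply, smul_assoc]
  rw [← Finset.smul_sum, hlin, smul_smul, inv_mul_cancel₀ ht₀pos.ne', one_smul]

end

theorem linearIndepOn_iff_card_le_finrank_image {σ W : Type*} [Fintype σ] [AddCommGroup W]
    [Module ℝ W] (v : σ → W) (S : Set σ) :
    LinearIndepOn ℝ v S ↔ Nat.card S ≤ Set.finrank ℝ (v '' S) := by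
  classical
  rw [LinearIndepOn, linearIndependent_iff_card_le_finrank_span, ← Nat.card_eq_fintype_card,
    image_eq_range]

theorem LinearIndepOn.finrank_image_eq {σ W : Type*} [Fintype σ] [AddCommGroup W]
    [Module ℝ W] {v : σ → W} {S : Set σ} (h : LinearIndepOn ℝ v S) :
    Set.finrank ℝ (v '' S) = Nat.card S := by
  classical
  rw [Nat.card_eq_fintype_card, image_eq_range]
  exact finrank_span_eq_card h

section

variable {σ E : Type*} [Fintype σ] [NormedAddCommGroup E] [NormedSpace ℝ E]

theorem LinearIndepOn.eventually_apply {a : σ → E → E} {y : E} {J : Set σ}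
    (ha : ∀ s, ContinuousAt (a s) y) (hJ : LinearIndepOn ℝ (fun s => a s y) J) :
    ∀ᶠ z in 𝓝 y, LinearIndepOn ℝ (fun s => a s z) J := by
  have hc : Tendsto (fun z (s : J) => a s z) (𝓝 y) (𝓝 fun s : J => a s y) :=
    tendsto_pi_nhds.2 fun s => ha s
  exact hc.eventually (LinearIndependent.eventually hJ)

/-- At nearby points each combination can be rewritten over an independent family `J ∪ K`, with `J`
a basis of the equality part. Constant rank carries this independence back to `y`. So near `y` the
graph lies in a finite union of graphs, each closed at `y` by the bounded-multiplier argument. -/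
theorem mem_multiplierGraph_of_constant_rank {a : σ → E → E} {Q I : Set σ} {y w : E}
    (ha : ∀ s, ContinuousAt (a s) y)
    (hrank : ∀ K ⊆ I, ∀ᶠ z in 𝓝 y, Set.finrank ℝ ((fun s => a s z) '' (Q ∪ K)) =
      Set.finrank ℝ ((fun s => a s y) '' (Q ∪ K)))
    (h : (y, w) ∈ closure (multiplierGraph a Qᶜ (Q ∪ I))) :
    (y, w) ∈ multiplierGraph a Qᶜ (Q ∪ I) := by
  obtain ⟨J, hJQ, -, hJspan, hJ⟩ := exists_linearIndepOn_extension
    (linearIndepOn_empty ℝ (fun s => a s y)) (empty_subset Q)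
  have hspan : ∀ (z : E) (K : Set σ),
      (fun s => a s z) '' Q ⊆ Submodule.span ℝ ((fun s => a s z) '' J) →
      Set.finrank ℝ ((fun s => a s z) '' (Q ∪ K)) =
        Set.finrank ℝ ((fun s => a s z) '' (J ∪ K)) := fun z K hz => by
    have : Submodule.span ℝ ((fun s => a s z) '' (Q ∪ K)) =
        Submodule.span ℝ ((fun s => a s z) '' (J ∪ K)) := by
      refine le_antisymm (Submodule.span_le.2 ?_)
        (Submodule.span_mono (image_mono (union_subset_union_left K hJQ)))
      rw [image_union]
      refine union_subset (hz.trans (Submodule.span_mono (image_mono subset_union_left))) ?_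
      exact (image_mono subset_union_right).trans Submodule.subset_span
    rw [Set.finrank, Set.finrank, this]
  have hev : ∀ᶠ z in 𝓝 y, ∀ K : Set σ, K ⊆ I →
      Set.finrank ℝ ((fun s => a s z) '' (Q ∪ K)) =
        Set.finrank ℝ ((fun s => a s y) '' (Q ∪ K)) :=
    eventually_all.2 fun K => by
      by_cases hK : K ⊆ I
      · exact (hrank K hK).mono fun z hz _ => hz
      · exact .of_forall fun z h => (hK h).elim
  have key : ∀ᶠ z in 𝓝 y, ∀ w' : E, (z, w') ∈ multiplierGraph a Qᶜ (Q ∪ I) →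
      (z, w') ∈ ⋃ K : {K : Set σ // K ⊆ I ∧ LinearIndepOn ℝ (fun s => a s y) (J ∪ K)},
        multiplierGraph a Qᶜ (J ∪ K) := by
    filter_upwards [hev, hJ.eventually_apply ha] with z hz hJz w' ⟨β, hβ0, hβS, hβ⟩
    have hQz : (fun s => a s z) '' Q ⊆ Submodule.span ℝ ((fun s => a s z) '' J) := by
      have hfin : Set.finrank ℝ ((fun s => a s z) '' J) = Set.finrank ℝ ((fun s => a s z) '' Q) := by
        have h1 := hz ∅ (empty_subset _)
        have h2 := hspan y ∅ hJspan
        simp only [union_empty] at h1 h2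
        rw [h1, h2, hJ.finrank_image_eq, hJz.finrank_image_eq]
      have : FiniteDimensional ℝ (Submodule.span ℝ ((fun s => a s z) '' Q)) :=
        FiniteDimensional.span_of_finite ℝ (toFinite _)
      rw [Submodule.eq_of_le_of_finrank_eq (Submodule.span_mono (image_mono hJQ)) hfin]
      exact Submodule.subset_span
    obtain ⟨K, hK, hLI, β', h1, h2, h3⟩ :=
      exists_linearIndepOn_union_sum_smul_eq (fun s => a s z) hJQ hJz hQz β hβ0
    have hKI : K ⊆ I := fun s hs => by
      by_contra hsI
      exact (hK hs).1 (hβS s fun h => h.elim (hK hs).2 hsI)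
    refine mem_iUnion.2 ⟨⟨K, hKI, ?_⟩, β', h1, h2, h3.trans hβ⟩
    -- Rank comparison: `J ∪ K` and `Q ∪ K` have equal rank both at `y` and at `z`, and the rank of
    -- `Q ∪ K` is the same at the two points.
    rw [linearIndepOn_iff_card_le_finrank_image] at hLI ⊢
    rwa [← hspan y K hJspan, ← hz K hKI, hspan z K hQz]
  have hcl : (y, w) ∈ closure
      (⋃ K : {K : Set σ // K ⊆ I ∧ LinearIndepOn ℝ (fun s => a s y) (J ∪ K)},
        multiplierGraph a Qᶜ (J ∪ K)) := by
    rw [mem_closure_iff_frequently] at h ⊢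
    refine (h.and_eventually ((continuous_fst.tendsto (y, w)).eventually key)).mono ?_
    exact fun p hp => hp.2 p.2 hp.1
  rw [closure_iUnion_of_finite] at hcl
  obtain ⟨⟨K, hKI, hLI⟩, hK⟩ := mem_iUnion.1 hcl
  obtain ⟨β, h1, h2, h3⟩ := mem_multiplierGraph_of_mem_closure ha (fun γ _ hγ hsum => by
    classical
    have := linearIndepOn_iff'.1 hLI (Finset.univ.filter (· ∈ J ∪ K)) γ
      (fun s hs => by simpa using hs) (by
      rw [← hsum]
      refine Finset.sum_subset (Finset.subset_univ _) fun s _ hs => ?_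
      rw [hγ s (by simpa using hs), zero_smul])
    funext s
    by_cases hs : s ∈ J ∪ K
    · exact this s (by simpa using hs)
    · exact hγ s hs) hK
  exact ⟨β, h1, fun s hs => h2 s fun h => hs (union_subset_union hJQ hKI h), h3⟩

end

/-! ### Approximate multipliers by quadratic penalization -/

section

variable {σ E : Type*} [Fintype σ] [NormedAddCommGroup E] [InnerProductSpace ℝ E]
  [FiniteDimensional ℝ E]

/-- For a large penalty `k`, the penalized objective has an unconstrained local minimizer `y` near
`y₀`; its stationarity equation exhibits `∇ f y - (y - y₀)` as a combination with multipliers `k * p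
s y`. -/
theorem mem_closure_multiplierGraph_of_isLocalMaxOn {f : E → ℝ} {g : σ → E → ℝ} {N : Set σ}
    {y₀ : E} (hf : ContDiff ℝ 1 f) (hg : ∀ s, ContDiff ℝ 1 (g s))
    (hy₀N : ∀ s ∈ N, g s y₀ ≤ 0) (hy₀ : ∀ s ∉ N, g s y₀ = 0)
    (hmax : IsLocalMaxOn f {y | (∀ s ∈ N, g s y ≤ 0) ∧ ∀ s ∉ N, g s y = 0} y₀) :
    (y₀, ∇ f y₀) ∈ closure (multiplierGraph (fun s => ∇ (g s)) N {s | g s y₀ = 0}) := by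
  classical
  have hgradc : Continuous (∇ f) :=
    (InnerProductSpace.toDual ℝ E).symm.continuous.comp (hf.continuous_fderiv one_ne_zero)
  set p : σ → E → ℝ := fun s y => if s ∈ N then max (g s y) 0 else g s y with hp
  have hpc : ∀ s, Continuous (p s) := fun s => by
    by_cases hs : s ∈ N
    · simpa [hp, hs] using (hg s).continuous.max continuous_const
    · simpa [hp, hs] using (hg s).continuous
  have hp0 : ∀ s, p s y₀ = 0 := fun s => by
    by_cases hs : s ∈ N
    · simpa [hp, hs] using hy₀N s hs
    · simpa [hp, hs] using hy₀ s hs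
  set F : ℕ → E → ℝ := fun k y => -f y + 2⁻¹ * ‖y - y₀‖ ^ 2 + k * (2⁻¹ * ∑ s, p s y ^ 2) with hF
  have hFc : ∀ k, Continuous (F k) := fun k => by
    have := hf.continuous
    simp only [hF]
    fun_prop
  rw [Metric.mem_closure_iff]
  intro ε hε
  have hev : ∀ᶠ y in 𝓝 y₀, ((∀ s ∈ N, g s y ≤ 0) ∧ (∀ s ∉ N, g s y = 0) → f y ≤ f y₀) ∧
      (∀ s, g s y₀ < 0 → g s y < 0) ∧ dist (∇ f y) (∇ f y₀) < ε / 2 := by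
    refine (eventually_nhdsWithin_iff.1 hmax).and ((eventually_all.2 fun s => ?_).and ?_)
    · by_cases hs : g s y₀ < 0
      · exact ((hg s).continuous.continuousAt.eventually_lt_const hs).mono fun y hy _ => hy
      · exact .of_forall fun y h => (hs h).elim
    · exact Metric.tendsto_nhds.1 hgradc.continuousAt _ (half_pos hε)
  obtain ⟨r', hr', hball⟩ := Metric.nhds_basis_closedBall.eventually_iff.1 hev
  set r := min r' (ε / 3) with hr
  have hr0 : 0 < r := lt_min hr' (by positivity)
  replace hball : ∀ y ∈ Metric.closedBall y₀ r, _ := fun y hy =>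
    hball (Metric.closedBall_subset_closedBall (min_le_left _ _) hy)
  -- On the sphere, feasible points are handled by the proximal term and infeasible ones by a large
  -- penalty. Compactness and monotonicity in `k` give one `k` for all, so the minimizer over the
  -- ball is interior.
  obtain ⟨k, hk⟩ : ∃ k : ℕ, Metric.sphere y₀ r ⊆ {y | -f y₀ < F k y} := by
    refine (isCompact_sphere y₀ r).elim_directed_cover (fun k : ℕ => {y | -f y₀ < F k y})
      (fun k => isOpen_lt continuous_const (hFc k)) (fun y hy => ?_) ?_
    · obtain ⟨h1, -, -⟩ := hball y (Metric.sphere_subset_closedBall hy)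
      have hyr : ‖y - y₀‖ = r := by simpa [dist_eq_norm] using hy
      rw [mem_iUnion]
      rcases (Finset.sum_nonneg fun s (_ : s ∈ Finset.univ) => sq_nonneg (p s y)).eq_or_lt with h | h
      · have hz : ∀ s, p s y = 0 := fun s => by
          simpa using (Finset.sum_eq_zero_iff_of_nonneg fun s _ => sq_nonneg (p s y)).1 h.symm s
            (Finset.mem_univ s)
        refine ⟨0, ?_⟩
        have := h1 ⟨fun s hs => by simpa [hp, hs] using hz s, fun s hs => by
          simpa [hp, hs] using hz s⟩
        have : 0 < r ^ 2 := by positivity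
        simp only [mem_ofPred_eq, hF, hyr, Nat.cast_zero, zero_mul]
        linarith
      · obtain ⟨k, hk⟩ := exists_nat_gt ((f y - f y₀) / (2⁻¹ * ∑ s, p s y ^ 2))
        refine ⟨k, ?_⟩
        rw [div_lt_iff₀ (by positivity)] at hk
        have : 0 < r ^ 2 := by positivity
        simp only [mem_ofPred_eq, hF, hyr]
        linarith
    · refine (monotone_nat_of_le_succ fun k y hy => ?_).directed_le
      have : 0 ≤ ∑ s, p s y ^ 2 := Finset.sum_nonneg fun s _ => sq_nonneg _
      simp only [mem_ofPred_eq, hF, Nat.cast_add, Nat.cast_one] at hy ⊢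
      linarith
  obtain ⟨y, hy, hmin⟩ := (isCompact_closedBall y₀ r).exists_isMinOn
    ⟨y₀, Metric.mem_closedBall_self hr0.le⟩ (hFc k).continuousOn
  have hFy : F k y ≤ -f y₀ := by
    have := hmin (Metric.mem_closedBall_self hr0.le)
    simpa [hF, hp0] using this
  have hyb : y ∈ Metric.ball y₀ r := by
    refine lt_of_le_of_ne (Metric.mem_closedBall.1 hy) fun h => ?_
    exact absurd (hk h) (not_lt.2 hFy)
  obtain ⟨-, hneg, hgrad⟩ := hball y hy
  -- Freezing the slack at `y` replaces `max (g s z) 0 ^ 2` by the smooth majorant `(g s z - c s) ^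
  -- 2`, with equality at `y`. Hence `y` also minimizes `G` locally, and the squared positive part
  -- need not be differentiated.
  set c : σ → ℝ := fun s => if s ∈ N then min (g s y) 0 else 0 with hc
  have hpc' : ∀ s, p s y = g s y - c s := fun s => by
    by_cases hs : s ∈ N
    · simp only [hp, hc, hs, if_true]
      linarith [max_add_min (g s y) 0]
    · simp [hp, hc, hs]
  have hple : ∀ s z, p s z ^ 2 ≤ (g s z - c s) ^ 2 := fun s z => by
    by_cases hs : s ∈ N
    · simp only [hp, hc, hs, if_true]
      have : min (g s y) 0 ≤ 0 := min_le_right _ _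
      rcases le_total (g s z) 0 with h | h
      · simpa [max_eq_right h] using sq_nonneg _
      · rw [max_eq_left h]
        exact pow_le_pow_left₀ h (by linarith) 2
    · simp [hp, hc, hs]
  set G : E → ℝ := fun z => -f z + 2⁻¹ * ‖z - y₀‖ ^ 2 + k * (2⁻¹ * ∑ s, (g s z - c s) ^ 2) with hG
  have hGmin : IsLocalMin G y := by
    filter_upwards [Metric.isOpen_ball.mem_nhds hyb] with z hz
    calc G y = F k y := by simp only [hG, hF, hpc']
      _ ≤ F k z := hmin (Metric.ball_subset_closedBall hz)
      _ ≤ G z := by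
        simp only [hF, hG]
        gcongr (_ + k * (2⁻¹ * ?_))
        exact Finset.sum_le_sum fun s _ => hple s z
  have hfd : HasFDerivAt f (InnerProductSpace.toDual ℝ E (∇ f y)) y :=
    ((hf.differentiable one_ne_zero) y).hasGradientAt.hasFDerivAt
  have hgd : ∀ s, HasFDerivAt (g s) (InnerProductSpace.toDual ℝ E (∇ (g s) y)) y := fun s =>
    (((hg s).differentiable one_ne_zero) y).hasGradientAt.hasFDerivAt
  have hGd : HasFDerivAt G (InnerProductSpace.toDual ℝ E
      (-∇ f y + (y - y₀) + ∑ s, (k * p s y) • ∇ (g s) y)) y := by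
    have h1 : HasFDerivAt (fun z => ‖z - y₀‖ ^ 2) _ y :=
      ((hasFDerivAt_id y).sub_const y₀).norm_sq
    have h2 : ∀ s, HasFDerivAt (fun z => (g s z - c s) ^ 2) _ y := fun s =>
      ((hgd s).sub_const (c s)).pow 2
    have h3 := (hfd.neg.add (h1.const_mul 2⁻¹)).add
      (((HasFDerivAt.fun_sum fun s (_ : s ∈ Finset.univ) => h2 s).const_mul 2⁻¹).const_mul (k : ℝ))
    refine h3.congr_fderiv ?_
    ext v
    simp [Finset.mul_sum, hpc']
    exact Finset.sum_congr rfl fun s _ => by ring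
  have hzero := hGmin.hasFDerivAt_eq_zero hGd
  rw [map_eq_zero_iff _ (InnerProductSpace.toDual ℝ E).injective] at hzero
  refine ⟨(y, ∇ f y - (y - y₀)), ⟨fun s => k * p s y, fun s hs => ?_, fun s hs => ?_, ?_⟩, ?_⟩
  · simp only [hp, hs, if_true]; positivity
  · have hsN : s ∈ N := by_contra fun h => hs (hy₀ s h)
    have := hneg s (lt_of_le_of_ne (hy₀N s hsN) hs)
    simp [hp, hsN, this.le]
  · rw [← sub_eq_zero, ← hzero]; simp only; abel
  · have hyr : dist y y₀ < ε / 3 := lt_of_lt_of_le hyb (min_le_right _ _)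
    rw [Prod.dist_eq, max_lt_iff]
    refine ⟨by rw [dist_comm]; linarith, ?_⟩
    simp only
    calc dist (∇ f y₀) (∇ f y - (y - y₀))
        ≤ dist (∇ f y₀) (∇ f y) + dist (∇ f y) (∇ f y - (y - y₀)) := dist_triangle _ _ _
      _ = dist (∇ f y) (∇ f y₀) + dist y y₀ := by rw [dist_comm, dist_self_sub_right, dist_eq_norm y]
      _ < ε := by linarith

end

/-! ### Farkas' lemma -/

section

variable {σ E : Type*} [Fintype σ] [NormedAddCommGroup E] [InnerProductSpace ℝ E]
  [FiniteDimensional ℝ E]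

/-- Farkas' lemma. -/
theorem exists_nonneg_add_sum_smul_eq_zero (N : Set σ) (h : σ → E →L[ℝ] ℝ) (l : E →L[ℝ] ℝ)
    (hl : ∀ u, (∀ s ∈ N, h s u ≤ 0) → (∀ s ∉ N, h s u = 0) → 0 ≤ l u) :
    ∃ α : σ → ℝ, (∀ s ∈ N, 0 ≤ α s) ∧ l + ∑ s, α s • h s = 0 := by
  have hgrad : ∀ (k : E →L[ℝ] ℝ) (u : E), ∇ k u = (InnerProductSpace.toDual ℝ E).symm k :=
    fun k u => by rw [gradient, k.fderiv]
  -- The hypothesis says that `0` maximizes `-l` over the polyhedral cone. Gradients of linear forms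
  -- are constant, so constant rank is automatic.
  have hcl := mem_closure_multiplierGraph_of_isLocalMaxOn (f := ⇑(-l)) (g := fun s => ⇑(h s))
    (N := N) (y₀ := 0) (-l).contDiff (fun s => (h s).contDiff) (by simp) (by simp) (by
      refine IsMaxOn.localize fun u hu => ?_
      simpa using hl u hu.1 hu.2)
  have huniv : {s | h s (0 : E) = 0} = Nᶜ ∪ univ := by simp
  have hconst : (fun s => ∇ ⇑(h s)) = fun s _ => (InnerProductSpace.toDual ℝ E).symm (h s) :=
    funext₂ fun s u => hgrad (h s) u
  rw [hconst, hgrad, huniv] at hcl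
  obtain ⟨α, hα, -, hsum⟩ := mem_multiplierGraph_of_constant_rank (Q := Nᶜ) (I := univ)
    (fun s => continuousAt_const) (fun K _ => .of_forall fun z => rfl)
    (by rw [compl_compl]; exact hcl)
  refine ⟨α, by simpa using hα, ?_⟩
  simp only at hsum
  have := congrArg (InnerProductSpace.toDual ℝ E) hsum
  simp only [map_sum, map_smul, LinearIsometryEquiv.apply_symm_apply] at this
  rw [this, add_neg_cancel]

end

/-! ### Stationarity on the linearized cone -/

section

variable {E : Type*} [NormedAddCommGroup E] [NormedSpace ℝ E] {p₁ p₂ : ℕ}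

/-- Along a linearized direction, `φ (x₀ + t • u)` is `o(t)`-close to the cone, so subregularity
gives feasible points within `o(t)` of `x₀ + t • u`; apply `hl` there, divide by `t` and let `ε →
0`. -/
theorem MSCQ.nonneg_of_mem_linearizedCone {φ : E → EucSum p₁ p₂} {x₀ : E}
    (hX : MSCQ φ (mixedCone p₁ p₂) x₀) {φ' : E →L[ℝ] EucSum p₁ p₂} (hφ : HasFDerivAt φ φ' x₀)
    {l : E →L[ℝ] ℝ} (hl : ∀ ε > 0, ∀ᶠ x in 𝓝[feasibleSet φ (mixedCone p₁ p₂)] x₀,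
      -(ε * ‖x - x₀‖) ≤ l (x - x₀)) {u : E}
    (hu₁ : ∀ i, φ x₀ (Sum.inl i) = 0 → φ' u (Sum.inl i) ≤ 0)
    (hu₂ : ∀ j, φ' u (Sum.inr j) = 0) : 0 ≤ l u := by
  obtain ⟨hx₀, U, hU, ρ, hρ, hdist⟩ := hX
  have key : ∀ ε > 0, -(ε * (‖u‖ + (ρ + 1) * ε + ‖l‖ * (ρ + 1))) ≤ l u := by
    intro ε hε
    obtain ⟨η, hη, hball⟩ := Metric.eventually_nhds_iff.1
      (eventually_nhdsWithin_iff.1 (hl ε hε))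
    have hline : Tendsto (fun t : ℝ => x₀ + t • u) (𝓝[>] 0) (𝓝 x₀) := by
      have : ContinuousAt (fun t : ℝ => x₀ + t • u) 0 := by fun_prop
      simpa using this.tendsto.mono_left nhdsWithin_le_nhds
    have hderiv : ∀ᶠ t : ℝ in 𝓝[>] 0,
        ‖φ (x₀ + t • u) - (φ x₀ + t • φ' u)‖ ≤ ε * t := by
      have h1 : HasDerivAt (fun t : ℝ => φ (x₀ + t • u)) (φ' u) 0 := by
        have h2 : HasDerivAt (fun t : ℝ => x₀ + t • u) u 0 := by
          simpa using ((hasDerivAt_id (0 : ℝ)).smul_const u).const_add x₀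
        exact HasFDerivAt.comp_hasDerivAt (0 : ℝ) (by simpa using hφ) h2
      have h3 := (hasDerivAt_iff_isLittleO.1 h1).def hε
      filter_upwards [h3.filter_mono nhdsWithin_le_nhds, self_mem_nhdsWithin] with t ht ht0
      simpa [abs_of_pos (mem_Ioi.1 ht0), sub_sub] using ht
    have hcone : ∀ᶠ t : ℝ in 𝓝[>] 0, φ x₀ + t • φ' u ∈ mixedCone p₁ p₂ := by
      have : ∀ᶠ t : ℝ in 𝓝[>] 0, ∀ i : Fin p₁, φ x₀ (Sum.inl i) + t * φ' u (Sum.inl i) ≤ 0 := by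
        refine eventually_all.2 fun i => ?_
        rcases (hx₀.1 i).eq_or_lt with h | h
        · filter_upwards [self_mem_nhdsWithin] with t ht
          rw [h, zero_add]
          exact mul_nonpos_of_nonneg_of_nonpos (mem_Ioi.1 ht).le (hu₁ i h)
        · have hc : ContinuousAt (fun t : ℝ => φ x₀ (Sum.inl i) + t * φ' u (Sum.inl i)) 0 := by
            fun_prop
          refine ((hc.eventually_lt_const (u := 0) (by simpa using h)).filter_mono
            nhdsWithin_le_nhds).mono fun t ht => ht.le
      filter_upwards [this] with t ht
      exact ⟨fun i => by simpa using ht i, fun j => by simp [hu₂ j, hx₀.2 j]⟩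
    have hsmall : ∀ᶠ t : ℝ in 𝓝[>] 0, t * (‖u‖ + (ρ + 1) * ε) < η := by
      have hc : ContinuousAt (fun t : ℝ => t * (‖u‖ + (ρ + 1) * ε)) 0 := by fun_prop
      exact (hc.eventually_lt_const (by simpa using hη)).filter_mono nhdsWithin_le_nhds
    obtain ⟨t, htU, htd, htc, hts, ht0⟩ := ((hline.eventually hU).and (hderiv.and (hcone.and
      (hsmall.and self_mem_nhdsWithin)))).exists
    replace ht0 : 0 < t := ht0
    -- `ρ + 1` in place of `ρ` makes the inequality strict, so that a feasible point realizes it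
    -- even if the infimum is not attained.
    have hinf : Metric.infDist (x₀ + t • u) (feasibleSet φ (mixedCone p₁ p₂)) <
        (ρ + 1) * (ε * t) := by
      have h1 : Metric.infDist (φ (x₀ + t • u)) (mixedCone p₁ p₂) ≤ ε * t :=
        (Metric.infDist_le_dist_of_mem htc).trans (by rwa [dist_eq_norm])
      calc _ ≤ ρ * Metric.infDist (φ (x₀ + t • u)) (mixedCone p₁ p₂) := hdist _ htU
        _ ≤ ρ * (ε * t) := by gcongr
        _ < (ρ + 1) * (ε * t) := by
          have := mul_pos hε ht0
          gcongr; linarith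
    obtain ⟨x, hx, hxd⟩ := (Metric.infDist_lt_iff ⟨x₀, hx₀⟩).1 hinf
    rw [dist_eq_norm] at hxd
    have hxx : ‖x - x₀‖ ≤ t * (‖u‖ + (ρ + 1) * ε) := by
      calc ‖x - x₀‖ = ‖t • u - (x₀ + t • u - x)‖ := by congr 1; abel
        _ ≤ ‖t • u‖ + ‖x₀ + t • u - x‖ := norm_sub_le _ _
        _ ≤ t * ‖u‖ + (ρ + 1) * (ε * t) := by
          rw [norm_smul, Real.norm_of_nonneg ht0.le]; gcongr
        _ = _ := by ring
    have h1 := hball (show dist x x₀ < η by rw [dist_eq_norm]; exact hxx.trans_lt hts) hx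
    have h2 : -(‖l‖ * ((ρ + 1) * (ε * t))) ≤ l (x₀ + t • u - x) := by
      have := (l.le_opNorm (x₀ + t • u - x)).trans
        (mul_le_mul_of_nonneg_left hxd.le (norm_nonneg l))
      exact (abs_le.1 this).1
    have h3 : l (x - x₀) + l (x₀ + t • u - x) = t * l u := by
      rw [← map_add, ← smul_eq_mul, ← map_smul]; congr 1; abel
    have h4 := mul_le_mul_of_nonneg_left hxx hε.le
    refine le_of_mul_le_mul_left ?_ ht0
    linarith
  have hlim : Tendsto (fun ε : ℝ => -(ε * (‖u‖ + (ρ + 1) * ε + ‖l‖ * (ρ + 1)))) (𝓝[>] 0)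
      (𝓝 0) := by
    have : ContinuousAt (fun ε : ℝ => -(ε * (‖u‖ + (ρ + 1) * ε + ‖l‖ * (ρ + 1)))) 0 := by fun_prop
    simpa using this.tendsto.mono_left nhdsWithin_le_nhds
  exact le_of_tendsto hlim (eventually_mem_nhdsWithin.mono fun ε hε => key ε hε)

end

/-! ### Minimax points and the inner multiplier -/

section MinimaxPoint

variable {n m q₁ q₂ : ℕ}

theorem IsCalmLocalMinimax.neg_mul_norm_le {f : Euc n × Euc m → ℝ} {X : Set (Euc n)}
    {ψ : Euc n × Euc m → EucSum q₁ q₂} {x₀ : Euc n} {y₀ : Euc m}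
    (h : IsCalmLocalMinimax f X (feasibleMap ψ (mixedCone q₁ q₂)) x₀ y₀)
    {β : EucSum q₁ q₂} (hβ : ∀ i, 0 ≤ β (Sum.inl i)) (hβ0 : ⟪ψ (x₀, y₀), β⟫_ℝ = 0)
    {H' : Euc n × Euc m →L[ℝ] ℝ}
    (hH : HasFDerivAt (fun z => f z - ⟪ψ z, β⟫_ℝ) H' (x₀, y₀)) (hH0 : ∀ v, H' (0, v) = 0)
    {ε : ℝ} (hε : 0 < ε) :
    ∀ᶠ x in 𝓝[X] x₀, -(ε * ‖x - x₀‖) ≤ H' (x - x₀, 0) := by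
  obtain ⟨-, hy₀, δ₀, hδ₀, τ, -, ⟨κ, hκ, hτ⟩, hmm⟩ := h
  have hκ1 : (0 : ℝ) < 1 + κ := by positivity
  obtain ⟨η, hη, hball⟩ := Metric.eventually_nhds_iff.1
    ((hasFDerivAt_iff_isLittleO.1 hH).def (div_pos hε hκ1))
  have hnear : ∀ᶠ x in 𝓝 x₀, ‖x - x₀‖ < min (δ₀ : ℝ) (η / (1 + κ)) := by
    simp only [← dist_eq_norm]
    exact Metric.eventually_nhds_iff.2
      ⟨min (δ₀ : ℝ) (η / (1 + κ)), lt_min hδ₀ (div_pos hη hκ1), fun _ h => h⟩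
  filter_upwards [hnear.filter_mono nhdsWithin_le_nhds, self_mem_nhdsWithin] with x hx hxX
  obtain ⟨hx1, hx2⟩ := lt_min_iff.1 hx
  rcases eq_or_ne x x₀ with rfl | hne
  · have : H' (0, 0) = 0 := hH0 0
    simp [this]
  have hpos : 0 < ‖x - x₀‖ := norm_pos_iff.2 (sub_ne_zero.2 hne)
  -- The radius is exactly `‖x - x₀‖`, so calmness bounds the maximizer's displacement by `κ * ‖x -
  -- x₀‖`; `y₀` only fills the slot of the other inequality.
  obtain ⟨-, M, ⟨⟨y, ⟨hyY, hyb⟩, rfl⟩, -⟩, hM⟩ := hmm ‖x - x₀‖₊ (by exact_mod_cast hpos)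
    (by exact_mod_cast hx1.le) x ⟨hxX, by simp [dist_eq_norm]⟩ y₀
    ⟨hy₀, by simp⟩
  simp only at hM
  have hy : ‖y - y₀‖ ≤ κ * ‖x - x₀‖ := by
    have h1 : dist y y₀ ≤ τ ‖x - x₀‖₊ := hyb
    have h2 : (τ ‖x - x₀‖₊ : ℝ) ≤ κ * ‖x - x₀‖ := by exact_mod_cast hτ ‖x - x₀‖₊
    rw [← dist_eq_norm y y₀]
    exact h1.trans h2
  have hz : ‖(x, y) - (x₀, y₀)‖ ≤ (1 + κ) * ‖x - x₀‖ := by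
    rw [Prod.mk_sub_mk, Prod.norm_def]
    have : (0 : ℝ) ≤ κ * ‖x - x₀‖ := by positivity
    refine max_le ?_ ?_ <;> simp only <;> linarith
  have hlin := hball (y := (x, y)) (by
    rw [dist_eq_norm]
    refine hz.trans_lt ?_
    rwa [lt_div_iff₀' hκ1] at hx2)
  have hψ : ⟪ψ (x, y), β⟫_ℝ ≤ 0 := by
    have hyY' : ψ (x, y) ∈ mixedCone q₁ q₂ := hyY
    rw [PiLp.inner_apply, Fintype.sum_sum_type]
    have h1 : ∑ i : Fin q₁, ⟪ψ (x, y) (Sum.inl i), β (Sum.inl i)⟫_ℝ ≤ 0 :=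
      Finset.sum_nonpos fun i _ => by
        simpa using mul_nonpos_of_nonneg_of_nonpos (hβ i) (hyY'.1 i)
    simpa [hyY'.2] using h1
  have hHsplit : H' ((x, y) - (x₀, y₀)) = H' (x - x₀, 0) := by
    have : ((x, y) - (x₀, y₀) : Euc n × Euc m) = (x - x₀, 0) + (0, y - y₀) := by simp
    rw [this, map_add, hH0, add_zero]
  rw [hHsplit, hβ0] at hlin
  have h1 := (abs_le.1 hlin).2
  have h2 : ε / (1 + κ) * ‖(x, y) - (x₀, y₀)‖ ≤ ε * ‖x - x₀‖ := by
    calc _ ≤ ε / (1 + κ) * ((1 + κ) * ‖x - x₀‖) := by gcongr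
      _ = _ := by field_simp
  linarith

theorem IsAffineInY.gradY_eq {ψ : Euc n × Euc m → EucSum q₁ q₂} (h : IsAffineInY ψ) (x : Euc n)
    (y y' : Euc m) (s : Fin q₁ ⊕ Fin q₂) : gradY ψ x y s = gradY ψ x y' s := by
  obtain ⟨a, B, c, -, h⟩ := h
  set L : Euc m →L[ℝ] ℝ := (EuclideanSpace.proj s).comp B.toContinuousLinearMap with hL
  have hfun : (fun y' : Euc m => ψ (x, y') s) = fun y' => L y' + (a x s + c s) := by
    funext y'
    rw [h]
    simp [hL]
    ring
  have hgrad : ∀ z, HasFDerivAt (fun y' : Euc m => ψ (x, y') s) L z := fun z => by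
    rw [hfun]
    exact L.hasFDerivAt.add_const _
  rw [gradY, gradY, gradient, gradient, (hgrad y).fderiv, (hgrad y').fderiv]

theorem setOf_eq_zero_eq_compl_range_union_image_activeSet {ψ : Euc n × Euc m → EucSum q₁ q₂} {x : Euc n}
    {y : Euc m} (h : y ∈ feasibleMap ψ (mixedCone q₁ q₂) x) :
    {s | ψ (x, y) s = 0} = (range Sum.inl)ᶜ ∪ Sum.inl '' activeSet ψ x y := by
  have h' : ψ (x, y) ∈ mixedCone q₁ q₂ := h
  ext (i | j)
  · simp [activeSet]
  · simp [h'.2 j]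

/-- Pairing the relation with `w` kills the inequality coefficients; independence of the equality
gradients kills the rest. -/
theorem MFCQ.eq_zero_of_sum_smul_gradY_eq_zero {ψ : Euc n × Euc m → EucSum q₁ q₂} {x : Euc n}
    {y : Euc m} (h : MFCQ ψ x y) {γ : Fin q₁ ⊕ Fin q₂ → ℝ} (hγ : ∀ i, 0 ≤ γ (Sum.inl i))
    (hγ0 : ∀ i ∉ activeSet ψ x y, γ (Sum.inl i) = 0) (hsum : ∑ s, γ s • gradY ψ x y s = 0) :
    γ = 0 := by
  obtain ⟨hli, w, hw0, hw⟩ := h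
  have hinner : ∑ i, γ (Sum.inl i) * ⟪gradY ψ x y (Sum.inl i), w⟫_ℝ = 0 := by
    have := congrArg (fun v => ⟪v, w⟫_ℝ) hsum
    simpa [inner_add_left, sum_inner, inner_smul_left, hw0] using this
  have hterm : ∀ i, γ (Sum.inl i) * ⟪gradY ψ x y (Sum.inl i), w⟫_ℝ ≤ 0 := fun i => by
    by_cases hi : i ∈ activeSet ψ x y
    · exact mul_nonpos_of_nonneg_of_nonpos (hγ i) (hw i hi).le
    · simp [hγ0 i hi]
  have hinl : ∀ i, γ (Sum.inl i) = 0 := fun i => by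
    by_cases hi : i ∈ activeSet ψ x y
    · have := (Finset.sum_eq_zero_iff_of_nonpos fun i _ => hterm i).1 hinner i (Finset.mem_univ i)
      exact (mul_eq_zero.1 this).resolve_right (hw i hi).ne
    · exact hγ0 i hi
  simp only [Fintype.sum_sum_type, hinl, zero_smul, Finset.sum_const_zero, zero_add] at hsum
  have hinr := Fintype.linearIndependent_iff.1 hli _ hsum
  funext s
  rcases s with i | j
  · exact hinl i
  · exact hinr j

theorem RCRCQ.eventually_finrank_eq {ψ : Euc n × Euc m → EucSum q₁ q₂} {x : Euc n} {y : Euc m}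
    (h : RCRCQ ψ x y) {K : Set (Fin q₁ ⊕ Fin q₂)} (hK : K ⊆ Sum.inl '' activeSet ψ x y) :
    ∀ᶠ z in 𝓝 y, Set.finrank ℝ ((fun s => gradY ψ x z s) '' ((range Sum.inl)ᶜ ∪ K)) =
      Set.finrank ℝ ((fun s => gradY ψ x y s) '' ((range Sum.inl)ᶜ ∪ K)) := by
  obtain ⟨K', hK', rfl⟩ := subset_image_iff.1 hK
  have hc : Tendsto (fun z : Euc m => (x, z)) (𝓝 y) (𝓝 (x, y)) :=
    (Continuous.prodMk_right x).tendsto y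
  rw [compl_range_inl]
  exact hc.eventually (h K' hK')

theorem mem_multiplierGraph_gradY_of_constraintQualification {ψ : Euc n × Euc m → EucSum q₁ q₂}
    (hψ : ContDiff ℝ 1 ψ) {x : Euc n} {y w : Euc m} (hy : y ∈ feasibleMap ψ (mixedCone q₁ q₂) x)
    (hY : MFCQ ψ x y ∨ RCRCQ ψ x y ∨ IsAffineInY ψ)
    (h : (y, w) ∈ closure (multiplierGraph (fun s z => gradY ψ x z s) (range Sum.inl)
      {s | ψ (x, y) s = 0})) :
    (y, w) ∈ multiplierGraph (fun s z => gradY ψ x z s) (range Sum.inl) {s | ψ (x, y) s = 0} := by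
  have hc : ∀ s, ContinuousAt (fun z => gradY ψ x z s) y := fun s => by
    have hs : ContDiff ℝ 1 fun y' : Euc m => ψ (x, y') s := by fun_prop
    exact ((InnerProductSpace.toDual ℝ (Euc m)).symm.continuous.comp
      (hs.continuous_fderiv one_ne_zero)).continuousAt
  rcases hY with hY | hY
  · refine mem_multiplierGraph_of_mem_closure hc (fun γ hγ hγ0 hsum => ?_) h
    exact hY.eq_zero_of_sum_smul_gradY_eq_zero (fun i => hγ _ (mem_range_self i))
      (fun i hi => hγ0 _ hi) hsum
  · rw [setOf_eq_zero_eq_compl_range_union_image_activeSet hy] at h ⊢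
    -- Exhibits the sign-constrained indices as `Qᶜ`, with `Q` the equality indices.
    rw [← compl_compl (range (Sum.inl : Fin q₁ → Fin q₁ ⊕ Fin q₂)), compl_compl (range _)ᶜ] at h ⊢
    refine mem_multiplierGraph_of_constant_rank hc (fun K hK => ?_) h
    rcases hY with hY | hY
    · exact hY.eventually_finrank_eq hK
    · refine .of_forall fun z => ?_
      simp only [hY.gradY_eq x z y]

theorem inner_gradY {ψ : Euc n × Euc m → EucSum q₁ q₂} {x : Euc n} {y : Euc m}
    {ψ' : Euc n × Euc m →L[ℝ] EucSum q₁ q₂} (hψ : HasFDerivAt ψ ψ' (x, y))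
    (s : Fin q₁ ⊕ Fin q₂) (v : Euc m) : ⟪gradY ψ x y s, v⟫_ℝ = ψ' (0, v) s := by
  have h1 : HasFDerivAt (fun y' : Euc m => ψ (x, y'))
      (ψ'.comp (ContinuousLinearMap.inr ℝ (Euc n) (Euc m))) y :=
    hψ.comp y (hasFDerivAt_prodMk_right x y)
  have h2 : HasFDerivAt (fun y' : Euc m => ψ (x, y') s) ((EuclideanSpace.proj s).comp
      (ψ'.comp (ContinuousLinearMap.inr ℝ (Euc n) (Euc m)))) y :=
    (EuclideanSpace.proj s : EucSum q₁ q₂ →L[ℝ] ℝ).hasFDerivAt.comp y h1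
  rw [gradY, gradient, h2.fderiv, InnerProductSpace.toDual_symm_apply]
  rfl

theorem exists_multiplier_of_isLocalMaxOn {f : Euc n × Euc m → ℝ}
    {ψ : Euc n × Euc m → EucSum q₁ q₂} (hf : ContDiff ℝ 1 f) (hψ : ContDiff ℝ 1 ψ) {x : Euc n}
    {y : Euc m} (hy : y ∈ feasibleMap ψ (mixedCone q₁ q₂) x)
    (hmax : IsLocalMaxOn (fun y' => f (x, y')) (feasibleMap ψ (mixedCone q₁ q₂) x) y)
    (hY : MFCQ ψ x y ∨ RCRCQ ψ x y ∨ IsAffineInY ψ) :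
    ∃ β : EucSum q₁ q₂, (∀ i, 0 ≤ β (Sum.inl i)) ∧ (∀ s, ψ (x, y) s * β s = 0) ∧
      ∀ v, fderiv ℝ f (x, y) (0, v) = ⟪fderiv ℝ ψ (x, y) (0, v), β⟫_ℝ := by
  have hy' : ψ (x, y) ∈ mixedCone q₁ q₂ := hy
  have hfeas : feasibleMap ψ (mixedCone q₁ q₂) x =
      {y' | (∀ s ∈ range (Sum.inl : Fin q₁ → Fin q₁ ⊕ Fin q₂), ψ (x, y') s ≤ 0) ∧
        ∀ s ∉ range (Sum.inl : Fin q₁ → Fin q₁ ⊕ Fin q₂), ψ (x, y') s = 0} := by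
    ext y'
    simp [feasibleMap, mixedCone]
  rw [hfeas] at hmax
  have hcl := mem_closure_multiplierGraph_of_isLocalMaxOn (f := fun y' => f (x, y'))
    (g := fun s y' => ψ (x, y') s) (by fun_prop) (fun s => by fun_prop)
    (by simpa using hy'.1) (by simpa using hy'.2) hmax
  obtain ⟨β, hβ, hβ0, hsum⟩ := mem_multiplierGraph_gradY_of_constraintQualification hψ hy hY hcl
  refine ⟨WithLp.toLp 2 β, fun i => hβ _ (mem_range_self i), fun s => ?_, fun v => ?_⟩
  · by_cases hs : ψ (x, y) s = 0
    · simp [hs]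
    · simp [hβ0 s hs]
  · have hf' := ((hf.differentiable one_ne_zero) (x, y)).hasFDerivAt
    have hψ' := ((hψ.differentiable one_ne_zero) (x, y)).hasFDerivAt
    have h1 : HasFDerivAt (fun y' : Euc m => f (x, y'))
        ((fderiv ℝ f (x, y)).comp (ContinuousLinearMap.inr ℝ (Euc n) (Euc m))) y :=
      hf'.comp y (hasFDerivAt_prodMk_right x y)
    have h2 := congrArg (fun u => ⟪u, v⟫_ℝ) hsum
    simp only [sum_inner, inner_smul_left, inner_gradY hψ'] at h2
    rw [gradient, h1.fderiv, InnerProductSpace.toDual_symm_apply] at h2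
    simp only [ContinuousLinearMap.comp_apply, ContinuousLinearMap.inr_apply] at h2
    rw [← h2, PiLp.inner_apply]
    exact Finset.sum_congr rfl fun s _ => by simp

end MinimaxPoint

theorem mainTheorem5 (n m p₁ p₂ q₁ q₂ : ℕ)
    (f : Euc n × Euc m → ℝ) (φ : Euc n → EucSum p₁ p₂) (ψ : Euc n × Euc m → EucSum q₁ q₂)
    (hf : ContDiff ℝ 1 f) (hφ : ContDiff ℝ 1 φ) (hψ : ContDiff ℝ 1 ψ)
    (xbar : Euc n) (ybar : Euc m)
    (hmm : IsCalmLocalMinimax f (feasibleSet φ (mixedCone p₁ p₂))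
      (feasibleMap ψ (mixedCone q₁ q₂)) xbar ybar)
    (hX : MSCQ φ (mixedCone p₁ p₂) xbar)
    (hY : MFCQ ψ xbar ybar ∨ RCRCQ ψ xbar ybar ∨
      (IsAffineInY ψ ∧ ∀ᶠ x in 𝓝 xbar, (feasibleMap ψ (mixedCone q₁ q₂) x).Nonempty)) :
    ∃ (α : EucSum p₁ p₂) (β : EucSum q₁ q₂),
      (∀ i : Fin p₁, 0 ≤ α (Sum.inl i)) ∧ (∀ i : Fin q₁, 0 ≤ β (Sum.inl i)) ∧
      ∑ i : Fin p₁, α (Sum.inl i) * φ xbar (Sum.inl i) = 0 ∧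
      ∑ i : Fin q₁, β (Sum.inl i) * ψ (xbar, ybar) (Sum.inl i) = 0 ∧
      HasFDerivAt (lagrangian f φ ψ α β) (0 : Euc n × Euc m →L[ℝ] ℝ) (xbar, ybar) := by
  classical
  have hmax : IsLocalMaxOn (fun y => f (xbar, y)) (feasibleMap ψ (mixedCone q₁ q₂) xbar) ybar := by
    obtain ⟨hx, hy, δ₀, hδ₀, τ, -, -, h⟩ := hmm
    refine eventually_nhdsWithin_iff.2 ?_
    filter_upwards [Metric.closedBall_mem_nhds ybar (NNReal.coe_pos.2 hδ₀)] with y hyb hyY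
    exact (h δ₀ hδ₀ le_rfl xbar ⟨hx, by simp⟩ y ⟨hyY, hyb⟩).1
  obtain ⟨β, hβ, hβ0, hβy⟩ := exists_multiplier_of_isLocalMaxOn hf hψ hmm.2.1 hmax
    (hY.imp_right (Or.imp_right And.left))
  have hf' := ((hf.differentiable one_ne_zero) (xbar, ybar)).hasFDerivAt
  have hψ' := ((hψ.differentiable one_ne_zero) (xbar, ybar)).hasFDerivAt
  have hφ' := ((hφ.differentiable one_ne_zero) xbar).hasFDerivAt
  set H' : Euc n × Euc m →L[ℝ] ℝ :=
    fderiv ℝ f (xbar, ybar) - (innerSL ℝ β).comp (fderiv ℝ ψ (xbar, ybar)) with hH'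
  have hH : HasFDerivAt (fun z => f z - ⟪ψ z, β⟫_ℝ) H' (xbar, ybar) := by
    simp only [real_inner_comm β]
    exact hf'.sub ((innerSL ℝ β).hasFDerivAt.comp (xbar, ybar) hψ')
  have hH0 : ∀ v, H' (0, v) = 0 := fun v => by
    simp [hH', hβy, real_inner_comm]
  have hinner : ⟪ψ (xbar, ybar), β⟫_ℝ = 0 := by
    rw [PiLp.inner_apply]
    exact Finset.sum_eq_zero fun s _ => by simpa [mul_comm] using hβ0 s
  have hcalm : ∀ ε > 0, ∀ᶠ x in 𝓝[feasibleSet φ (mixedCone p₁ p₂)] xbar,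
      -(ε * ‖x - xbar‖) ≤ H'.comp (ContinuousLinearMap.inl ℝ (Euc n) (Euc m)) (x - xbar) :=
    fun ε hε => hmm.neg_mul_norm_le hβ hinner hH hH0 hε
  have hx : φ xbar ∈ mixedCone p₁ p₂ := hX.1
  -- Inactive constraints enter as the zero functional, which imposes nothing on `u`. Their
  -- coefficients are then arbitrary and are reset to `0` in the final `α`, which gives
  -- complementarity.
  obtain ⟨α, hα, hsum⟩ := exists_nonneg_add_sum_smul_eq_zero (range Sum.inl)
    (fun s : Fin p₁ ⊕ Fin p₂ => if φ xbar s = 0 then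
      (EuclideanSpace.proj s).comp (fderiv ℝ φ xbar) else 0)
    (H'.comp (ContinuousLinearMap.inl ℝ (Euc n) (Euc m))) (fun u hu₁ hu₂ => by
      refine hX.nonneg_of_mem_linearizedCone hφ' hcalm (fun i hi => ?_) fun j => ?_
      · simpa [hi] using hu₁ (Sum.inl i) (mem_range_self i)
      · simpa [hx.2 j] using hu₂ (Sum.inr j) (by simp))
  refine ⟨WithLp.toLp 2 fun s => if φ xbar s = 0 then α s else 0, β, fun i => ?_, hβ, ?_, ?_, ?_⟩
  · by_cases hi : φ xbar (Sum.inl i) = 0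
    · simpa [hi] using hα _ (mem_range_self i)
    · simp [hi]
  · exact Finset.sum_eq_zero fun i _ => by simp +contextual
  · exact Finset.sum_eq_zero fun i _ => by rw [mul_comm]; exact hβ0 _
  · set a : EucSum p₁ p₂ := WithLp.toLp 2 fun s => if φ xbar s = 0 then α s else 0 with ha
    have h1 : HasFDerivAt (fun z : Euc n × Euc m => ⟪φ z.1, a⟫_ℝ)
        ((innerSL ℝ a).comp ((fderiv ℝ φ xbar).comp (ContinuousLinearMap.fst ℝ (Euc n) (Euc m))))
        (xbar, ybar) := by
      simp only [real_inner_comm a]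
      exact (innerSL ℝ a).hasFDerivAt.comp (xbar, ybar) (HasFDerivAt.comp (xbar, ybar)
        (g := φ) (f := Prod.fst) hφ' hasFDerivAt_fst)
    have h2 : lagrangian f φ ψ a β = fun z => (f z - ⟪ψ z, β⟫_ℝ) + ⟪φ z.1, a⟫_ℝ := by
      funext z
      rw [lagrangian]; ring
    rw [h2]
    refine (hH.add h1).congr_fderiv (ContinuousLinearMap.ext fun ⟨u, v⟩ => ?_)
    have h3 : H' (u, v) = H' (u, 0) := by
      have : ((u, v) : Euc n × Euc m) = (u, 0) + (0, v) := by simp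
      rw [this, map_add, hH0, add_zero]
    have h4 := DFunLike.congr_fun hsum u
    simp only [add_apply, ContinuousLinearMap.comp_apply,
      ContinuousLinearMap.inl_apply, sum_apply,
      smul_apply, zero_apply] at h4
    simp only [add_apply, ContinuousLinearMap.comp_apply,
      ContinuousLinearMap.coe_fst', innerSL_apply_apply, zero_apply, h3]
    rw [← h4, PiLp.inner_apply]
    congr 1
    refine Finset.sum_congr rfl fun s _ => ?_
    by_cases hs : φ xbar s = 0 <;> simp [ha, hs, mul_comm]
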